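/- Let $A_1,\dots,A_m\in\mathbb{C}^{n\times n}$, let $Q\in\mathbb{C}^{n\times n}$ be Hermitian positive definite, and let $\xi,\rho,\eta_1,\dots,\eta_m>0$. The equation $X-\sum_{i=1}^m A_i^*X^{-1}A_i=Q$ has a unique Hermitian positive definite solution $X$. For this $X$ put $B_i=X^{-1}A_i$ and $$L=I\otimes I+\sum_{i=1}^m B_i^T\otimes B_i^* ,$$ which is an invertible $n^2\times n^2$ matrix. Let $\Pi$ be the vec-permutation matrix, so that $\operatorname{vec}E^T=\Pi\operatorname{vec}E$ for all $E\in\mathbb{C}^{n\times n}$ (where $\operatorname{vec}$ stacks columns), and define real matrices $S,\Sigma,U_{i1},\Omega_{i1},U_{i2},\Omega_{i2}\in\mathbb{R}^{n^2\times n^2}$ by $$L^{-1}=S+\mathbf{i}\Sigma,\qquad L^{-1}(I\otimes B_i^*)=U_{i1}+\mathbf{i}\Omega_{i1},\qquad L^{-1}(B_i^T\otimes I)\Pi=U_{i2}+\mathbf{i}\Omega_{i2},$$ and set $$S_c=\begin{bmatrix}S&-\Sigma\\ \Sigma&S\end{bmatrix},\qquad U_i=\begin{bmatrix}U_{i1}+U_{i2}&\Omega_{i2}-\Omega_{i1}\\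 \Omega_{i1}+\Omega_{i2}&U_{i1}-U_{i2}\end{bmatrix}\quad(i=1,\dots,m).$$ Then the limit defining the condition number $$c(X)=\lim_{\delta\to0^+}\ \sup_{\left\|\left(\frac{\Delta A_1}{\eta_1},\dots,\frac{\Delta A_m}{\eta_m},\frac{\Delta Q}{\rho}\right)\right\|_F\le\delta}\frac{\|\Delta X\|_F}{\xi\,\delta}$$ exists, where the supremum is over $\Delta A_i\in\mathbb{C}^{n\times n}$ and Hermitian $\Delta Q$ with $Q+\Delta Q$ positive definite, and $X+\Delta X$ denotes the positive definite solution of the equation with $A_i,Q$ replaced by $A_i+\Delta A_i$, $Q+\Delta Q$; and $$c(X)=\frac1\xi\,\bigl\|(\rho S_c,\ \eta_1U_1,\ \dots,\ \eta_mU_m)\bigr\| ,$$ where $\|\cdot\|_F$ is the Frobenius norm and $\|\cdot\|$ is the spectral norm. -/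

import Mathlib

open Filter Topology
open scoped Matrix Kronecker ENNReal ComplexOrder

noncomputable section

namespace MatrixCond

section
open scoped Matrix.Norms.Frobenius

/-- The Frobenius norm of a complex matrix. -/
def frobNorm {r c : Type*} [Fintype r] [Fintype c] (M : Matrix r c ℂ) : ℝ := ‖M‖

end

section
open scoped Matrix.Norms.L2Operator

/-- The spectral norm (operator norm for the Euclidean norms) of a real matrix. -/
def specNorm {r c : Type*} [Fintype r] [Fintype c] [DecidableEq c] (M : Matrix r c ℝ) : ℝ := ‖M‖

end

/-- The block row `(M₁, …, Mₘ)`. -/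
def blockRow {m : ℕ} {r c R : Type*} (M : Fin m → Matrix r c R) : Matrix r (Fin m × c) R :=
  Matrix.of fun i p => M p.1 i p.2

variable {m n : ℕ}

/-- `X` is a positive definite solution of `X - ∑ᵢ Aᵢ* X⁻¹ Aᵢ = Q`. -/
def IsPosDefSolution (A : Fin m → Matrix (Fin n) (Fin n) ℂ) (Q X : Matrix (Fin n) (Fin n) ℂ) :
    Prop :=
  X.PosDef ∧ X - ∑ i, (A i)ᴴ * X⁻¹ * A i = Q

/-- `‖(ΔA₁/η₁, …, ΔAₘ/ηₘ, ΔQ/ρ)‖_F`. -/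
def perturbationNorm (η : Fin m → ℝ) (ρ : ℝ) (ΔA : Fin m → Matrix (Fin n) (Fin n) ℂ)
    (ΔQ : Matrix (Fin n) (Fin n) ℂ) : ℝ :=
  frobNorm (Matrix.fromCols (blockRow fun i => (η i)⁻¹ • ΔA i) (ρ⁻¹ • ΔQ))

/-- The supremum (in `[0, ∞]`) of `‖ΔX‖_F / (ξ δ)` over all perturbations of weighted size at most
`δ`, with `ΔQ` Hermitian and `Q + ΔQ` positive definite, where `X + ΔX` is a positive definite
solution of the perturbed equation. -/
def perturbationSup (ξ : ℝ) (η : Fin m → ℝ) (ρ : ℝ) (A : Fin m → Matrix (Fin n) (Fin n) ℂ)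
    (Q X : Matrix (Fin n) (Fin n) ℂ) (δ : ℝ) : ℝ≥0∞ :=
  ⨆ (ΔA : Fin m → Matrix (Fin n) (Fin n) ℂ) (ΔQ : Matrix (Fin n) (Fin n) ℂ)
    (ΔX : Matrix (Fin n) (Fin n) ℂ)
    (_ : perturbationNorm η ρ ΔA ΔQ ≤ δ ∧ ΔQ.IsHermitian ∧ (Q + ΔQ).PosDef ∧
      IsPosDefSolution (fun i => A i + ΔA i) (Q + ΔQ) (X + ΔX)),
    ENNReal.ofReal (frobNorm ΔX / (ξ * δ))

/-- `c` is the Rice condition number of the solution `X`: the limit of `perturbationSup` as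
`δ → 0⁺`, which in particular exists. -/
def IsConditionNumber (ξ : ℝ) (η : Fin m → ℝ) (ρ : ℝ) (A : Fin m → Matrix (Fin n) (Fin n) ℂ)
    (Q X : Matrix (Fin n) (Fin n) ℂ) (c : ℝ≥0∞) : Prop :=
  Tendsto (perturbationSup ξ η ρ A Q X) (𝓝[>] 0) (𝓝 c)

/-- `Bᵢ = X⁻¹ Aᵢ`. -/
def matB (A : Fin m → Matrix (Fin n) (Fin n) ℂ) (X : Matrix (Fin n) (Fin n) ℂ) (i : Fin m) :
    Matrix (Fin n) (Fin n) ℂ :=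
  X⁻¹ * A i

/-- `L = I ⊗ I + ∑ᵢ Bᵢᵀ ⊗ Bᵢ*`. -/
def matL (A : Fin m → Matrix (Fin n) (Fin n) ℂ) (X : Matrix (Fin n) (Fin n) ℂ) :
    Matrix (Fin n × Fin n) (Fin n × Fin n) ℂ :=
  (1 : Matrix (Fin n) (Fin n) ℂ) ⊗ₖ (1 : Matrix (Fin n) (Fin n) ℂ) +
    ∑ i, (matB A X i)ᵀ ⊗ₖ (matB A X i)ᴴ

/-- The vec-permutation matrix `Π`, with `vec Eᵀ = Π vec E`. -/
def vecPerm (n : ℕ) : Matrix (Fin n × Fin n) (Fin n × Fin n) ℂ :=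
  Matrix.of fun p q => if q = p.swap then 1 else 0

theorem vecPerm_mulVec_vec (E : Matrix (Fin n) (Fin n) ℂ) :
    vecPerm n *ᵥ E.vec = Eᵀ.vec := by
  ext p
  simp [vecPerm, Matrix.mulVec, dotProduct, Matrix.vec]

/-- Entrywise real part. -/
def rePart {r c : Type*} (M : Matrix r c ℂ) : Matrix r c ℝ := M.map Complex.re

/-- Entrywise imaginary part. -/
def imPart {r c : Type*} (M : Matrix r c ℂ) : Matrix r c ℝ := M.map Complex.im

/-- `S_c = [S, -Σ; Σ, S]`, where `L⁻¹ = S + 𝐢 Σ`. -/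
def matSc (A : Fin m → Matrix (Fin n) (Fin n) ℂ) (X : Matrix (Fin n) (Fin n) ℂ) :
    Matrix ((Fin n × Fin n) ⊕ (Fin n × Fin n)) ((Fin n × Fin n) ⊕ (Fin n × Fin n)) ℝ :=
  Matrix.fromBlocks (rePart (matL A X)⁻¹) (-imPart (matL A X)⁻¹)
    (imPart (matL A X)⁻¹) (rePart (matL A X)⁻¹)

/-- `L⁻¹ (I ⊗ Bᵢ*) = U_{i1} + 𝐢 Ω_{i1}`. -/
def matV1 (A : Fin m → Matrix (Fin n) (Fin n) ℂ) (X : Matrix (Fin n) (Fin n) ℂ) (i : Fin m) :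
    Matrix (Fin n × Fin n) (Fin n × Fin n) ℂ :=
  (matL A X)⁻¹ * ((1 : Matrix (Fin n) (Fin n) ℂ) ⊗ₖ (matB A X i)ᴴ)

/-- `L⁻¹ (Bᵢᵀ ⊗ I) Π = U_{i2} + 𝐢 Ω_{i2}`. -/
def matV2 (A : Fin m → Matrix (Fin n) (Fin n) ℂ) (X : Matrix (Fin n) (Fin n) ℂ) (i : Fin m) :
    Matrix (Fin n × Fin n) (Fin n × Fin n) ℂ :=
  (matL A X)⁻¹ * ((matB A X i)ᵀ ⊗ₖ (1 : Matrix (Fin n) (Fin n) ℂ)) * vecPerm n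

/-- `Uᵢ = [U_{i1} + U_{i2}, Ω_{i2} - Ω_{i1}; Ω_{i1} + Ω_{i2}, U_{i1} - U_{i2}]`. -/
def matU (A : Fin m → Matrix (Fin n) (Fin n) ℂ) (X : Matrix (Fin n) (Fin n) ℂ) (i : Fin m) :
    Matrix ((Fin n × Fin n) ⊕ (Fin n × Fin n)) ((Fin n × Fin n) ⊕ (Fin n × Fin n)) ℝ :=
  Matrix.fromBlocks
    (rePart (matV1 A X i) + rePart (matV2 A X i)) (imPart (matV2 A X i) - imPart (matV1 A X i))
    (imPart (matV1 A X i) + imPart (matV2 A X i)) (rePart (matV1 A X i) - rePart (matV2 A X i))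

end MatrixCond

end

/-! Near `(A, Q)` the positive definite solution is given by a map `φ` differentiable at `(A, Q)`,
so the Rice limit is the operator norm of its derivative `T`, restricted to perturbations with
Hermitian `F`. Differentiating the equation gives, for `Z = T (E, F)`, `Z + ∑ Bᵢ* Z Bᵢ = F + ∑ (Eᵢ*
Bᵢ + Bᵢ* Eᵢ)`. Applying `vec` turns the left side into `L vec Z`; separating real and imaginary
parts turns the solution operator into the stacked real matrix (`condMatrix_mulVec_packVec`).

Uniqueness of `X` and invertibility of `L` both come from `eq_zero_of_stein`: `X - ∑ Bᵢ* X Bᵢ = Q >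
0` makes the family `B` strictly contractive for `X`, and this forces `Z = -∑ Bᵢ* Z Cᵢ` to vanish.
Existence follows by continuation along `s • A`, `0 ≤ s ≤ 1`: the solvable `s` form a closed set by
a uniform bound on inverses, and the local branch extends past any solvable `s < 1`.

The spectral norm allows every complex `F`, the supremum only Hermitian ones. `specNorm_le` shows
that nothing is lost: the skew-Hermitian part of `F` produces a response orthogonal to the Hermitian
one. -/

noncomputable section

namespace MatrixCond

/-! ### Quadratic forms and openness of positive definiteness. -/

section QuadraticForm

variable {ι : Type*} [Fintype ι]

/-- The real quadratic form `u ↦ Re (u* X u)`. -/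
def quadForm (X : Matrix ι ι ℂ) (u : ι → ℂ) : ℝ := (star u ⬝ᵥ X *ᵥ u).re

theorem quadForm_sub (X Y : Matrix ι ι ℂ) (u : ι → ℂ) :
    quadForm (X - Y) u = quadForm X u - quadForm Y u := by
  simp [quadForm, Matrix.sub_mulVec]

theorem quadForm_sum {κ : Type*} (s : Finset κ) (X : κ → Matrix ι ι ℂ) (u : ι → ℂ) :
    quadForm (∑ i ∈ s, X i) u = ∑ i ∈ s, quadForm (X i) u := by
  simp [quadForm, Matrix.sum_mulVec, dotProduct_sum]

theorem star_dotProduct_conjugate_mulVec (Z B C : Matrix ι ι ℂ) (u v : ι → ℂ) :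
    star u ⬝ᵥ (Bᴴ * Z * C) *ᵥ v = star (B *ᵥ u) ⬝ᵥ Z *ᵥ (C *ᵥ v) := by
  rw [Matrix.star_mulVec, ← Matrix.mulVec_mulVec, ← Matrix.mulVec_mulVec,
    Matrix.dotProduct_mulVec (star u) Bᴴ]

theorem quadForm_conjugate (X B : Matrix ι ι ℂ) (u : ι → ℂ) :
    quadForm (Bᴴ * X * B) u = quadForm X (B *ᵥ u) := by
  rw [quadForm, quadForm, star_dotProduct_conjugate_mulVec]

theorem quadForm_smul (X : Matrix ι ι ℂ) (c : ℂ) (u : ι → ℂ) :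
    quadForm X (c • u) = ‖c‖ ^ 2 * quadForm X u := by
  rw [quadForm, quadForm, star_smul, Matrix.mulVec_smul, smul_dotProduct, dotProduct_smul,
    smul_smul, smul_eq_mul, Complex.star_def, ← Complex.normSq_eq_conj_mul_self,
    Complex.re_ofReal_mul, Complex.normSq_eq_norm_sq]

theorem quadForm_pos {X : Matrix ι ι ℂ} (hX : X.PosDef) {u : ι → ℂ} (hu : u ≠ 0) :
    0 < quadForm X u :=
  hX.re_dotProduct_pos hu

theorem quadForm_nonneg {X : Matrix ι ι ℂ} (hX : X.PosSemidef) (u : ι → ℂ) :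
    0 ≤ quadForm X u :=
  hX.re_dotProduct_nonneg u

theorem star_dotProduct_mulVec_eq_quadForm {X : Matrix ι ι ℂ} (hX : X.IsHermitian) (u : ι → ℂ) :
    star u ⬝ᵥ X *ᵥ u = quadForm X u := by
  have h : (star u ⬝ᵥ X *ᵥ u).im = 0 := hX.im_star_dotProduct_mulVec_self u
  apply Complex.ext <;> simp [quadForm, h]

theorem posDef_of_quadForm_pos {X : Matrix ι ι ℂ} (hX : X.IsHermitian)
    (h : ∀ u : ι → ℂ, u ≠ 0 → 0 < quadForm X u) : X.PosDef := by
  refine Matrix.PosDef.of_dotProduct_mulVec_pos hX fun u hu => ?_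
  rw [star_dotProduct_mulVec_eq_quadForm hX]
  exact_mod_cast h u hu

theorem posSemidef_of_quadForm_nonneg {X : Matrix ι ι ℂ} (hX : X.IsHermitian)
    (h : ∀ u : ι → ℂ, 0 ≤ quadForm X u) : X.PosSemidef := by
  refine Matrix.PosSemidef.of_dotProduct_mulVec_nonneg hX fun u => ?_
  rw [star_dotProduct_mulVec_eq_quadForm hX]
  exact_mod_cast h u

theorem continuous_quadForm :
    Continuous fun p : Matrix ι ι ℂ × (ι → ℂ) => quadForm p.1 p.2 := by
  unfold quadForm
  fun_prop

theorem posSemidef_isClosed : IsClosed {X : Matrix ι ι ℂ | X.PosSemidef} := by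
  have h : {X : Matrix ι ι ℂ | X.PosSemidef} =
      {X | Xᴴ = X} ∩ ⋂ u : ι → ℂ, {X | 0 ≤ quadForm X u} := by
    ext X
    simp only [Set.mem_ofPred_eq, Set.mem_inter_iff, Set.mem_iInter]
    exact ⟨fun h => ⟨h.1, quadForm_nonneg h⟩, fun h => posSemidef_of_quadForm_nonneg h.1 h.2⟩
  rw [h]
  refine (isClosed_eq (by fun_prop) continuous_id).inter (isClosed_iInter fun u => ?_)
  exact isClosed_le continuous_const
    (continuous_quadForm.comp (by fun_prop : Continuous fun X => (X, u)))

/-- Hermitian matrices close to a positive definite matrix are positive definite. -/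
theorem eventually_posDef {X : Matrix ι ι ℂ} (hX : X.PosDef) :
    ∀ᶠ Y in 𝓝 X, Y.IsHermitian → Y.PosDef := by
  have h : ∀ᶠ Y in 𝓝 X, ∀ u ∈ Metric.sphere (0 : ι → ℂ) 1, 0 < quadForm Y u := by
    -- Compactness of the sphere makes the neighbourhood of `X` uniform in `u`; homogeneity then
    -- covers all nonzero vectors.
    refine (isCompact_sphere _ _).eventually_forall_of_forall_eventually fun u hu => ?_
    refine continuous_quadForm.continuousAt.eventually_const_lt (quadForm_pos hX ?_)
    exact Metric.ne_of_mem_sphere hu one_ne_zero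
  filter_upwards [h] with Y hY hYh
  refine posDef_of_quadForm_pos hYh fun u hu => ?_
  have hu' : ‖u‖ ≠ 0 := norm_ne_zero_iff.2 hu
  have h1 := hY (((‖u‖⁻¹ : ℝ) : ℂ) • u) (by simp [norm_smul, hu'])
  rw [quadForm_smul] at h1
  exact pos_of_mul_pos_right h1 (by positivity)

end QuadraticForm

/-! ### A vanishing criterion for Stein equations. -/

section Stein

variable {ι κ : Type*} [Fintype ι] [Fintype κ]

/-- The extremal ratio of a sesquilinear form relative to two positive definite forms. -/
theorem exists_extremal_pair {X Y Z : Matrix ι ι ℂ} (hX : X.PosDef) (hY : Y.PosDef) (hZ : Z ≠ 0) :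
    ∃ M > 0, ∃ u₀ ≠ 0, ∃ v₀ ≠ 0,
      ‖star u₀ ⬝ᵥ Z *ᵥ v₀‖ ^ 2 = M * (quadForm X u₀ * quadForm Y v₀) ∧
      ∀ u v, ‖star u ⬝ᵥ Z *ᵥ v‖ ^ 2 ≤ M * (quadForm X u * quadForm Y v) := by
  obtain ⟨v₁, hv₁⟩ : ∃ v, Z *ᵥ v ≠ 0 := by
    by_contra! h
    exact hZ (Matrix.mulVec_injective (funext fun v => by simp [h v]))
  have hv₁0 : v₁ ≠ 0 := by
    rintro rfl
    simp at hv₁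
  set u₁ := Z *ᵥ v₁ with hu₁
  have h₁ : star u₁ ⬝ᵥ Z *ᵥ v₁ ≠ 0 := by
    rw [← hu₁]
    exact fun h => hv₁ (dotProduct_star_self_eq_zero.1 h)
  let K := Metric.sphere (0 : ι → ℂ) 1 ×ˢ Metric.sphere (0 : ι → ℂ) 1
  -- This ratio is invariant under scaling each vector separately, so its maximum over the compact
  -- product of spheres is a global one. The pair `(Z v₁, v₁)` shows that the maximum is positive.
  let f : (ι → ℂ) × (ι → ℂ) → ℝ := fun p =>
    ‖star p.1 ⬝ᵥ Z *ᵥ p.2‖ ^ 2 / (quadForm X p.1 * quadForm Y p.2)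
  have hKc : IsCompact K := (isCompact_sphere _ _).prod (isCompact_sphere _ _)
  have hne : ∀ u ∈ Metric.sphere (0 : ι → ℂ) 1, u ≠ 0 := fun u hu =>
    Metric.ne_of_mem_sphere hu one_ne_zero
  have hscale : ∀ u : ι → ℂ, u ≠ 0 → ∃ c : ℂ, c ≠ 0 ∧ c • u ∈ Metric.sphere (0 : ι → ℂ) 1 := by
    intro u hu
    have hu' : ‖u‖ ≠ 0 := norm_ne_zero_iff.2 hu
    exact ⟨((‖u‖⁻¹ : ℝ) : ℂ), by simpa using hu, by simp [norm_smul, hu']⟩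
  have hfs : ∀ (u v : ι → ℂ) (c d : ℂ), c ≠ 0 → d ≠ 0 → f (c • u, d • v) = f (u, v) := by
    intro u v c d hc hd
    have hc' : ‖c‖ ≠ 0 := norm_ne_zero_iff.2 hc
    have hd' : ‖d‖ ≠ 0 := norm_ne_zero_iff.2 hd
    simp only [f, quadForm_smul, star_smul, Matrix.mulVec_smul, smul_dotProduct, dotProduct_smul,
      norm_smul, norm_star]
    rw [show (‖d‖ * (‖c‖ * ‖star u ⬝ᵥ Z *ᵥ v‖)) ^ 2 =
        (‖c‖ ^ 2 * ‖d‖ ^ 2) * ‖star u ⬝ᵥ Z *ᵥ v‖ ^ 2 by ring,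
      show ‖c‖ ^ 2 * quadForm X u * (‖d‖ ^ 2 * quadForm Y v) =
        (‖c‖ ^ 2 * ‖d‖ ^ 2) * (quadForm X u * quadForm Y v) by ring]
    exact mul_div_mul_left _ _ (by positivity)
  have hKne : K.Nonempty := by
    obtain ⟨c, -, hc⟩ := hscale v₁ hv₁0
    exact ⟨(c • v₁, c • v₁), hc, hc⟩
  have hfc : ContinuousOn f K := by
    refine ContinuousOn.div (by fun_prop) ?_ ?_
    · exact ((continuous_quadForm.comp (by fun_prop : Continuous
        fun p : (ι → ℂ) × (ι → ℂ) => (X, p.1))).mul (continuous_quadForm.comp (by fun_prop :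
        Continuous fun p : (ι → ℂ) × (ι → ℂ) => (Y, p.2)))).continuousOn
    · rintro ⟨u, v⟩ ⟨hu, hv⟩
      exact (mul_pos (quadForm_pos hX (hne u hu)) (quadForm_pos hY (hne v hv))).ne'
  obtain ⟨⟨u₀, v₀⟩, ⟨hu₀, hv₀⟩, hmax⟩ := hKc.exists_isMaxOn hKne hfc
  have hpos : ∀ {u v : ι → ℂ}, u ≠ 0 → v ≠ 0 → 0 < quadForm X u * quadForm Y v :=
    fun hu hv => mul_pos (quadForm_pos hX hu) (quadForm_pos hY hv)
  have hall : ∀ u v : ι → ℂ, u ≠ 0 → v ≠ 0 → f (u, v) ≤ f (u₀, v₀) := by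
    intro u v hu hv
    obtain ⟨c, hc, hcu⟩ := hscale u hu
    obtain ⟨d, hd, hdv⟩ := hscale v hv
    rw [← hfs u v c d hc hd]
    exact hmax ⟨hcu, hdv⟩
  refine ⟨f (u₀, v₀), ?_, u₀, hne _ hu₀, v₀, hne _ hv₀, ?_, ?_⟩
  · exact lt_of_lt_of_le (div_pos (by positivity) (hpos hv₁ hv₁0)) (hall u₁ v₁ hv₁ hv₁0)
  · exact (div_mul_cancel₀ _ (hpos (hne _ hu₀) (hne _ hv₀)).ne').symm
  · intro u v
    by_cases hu : u = 0
    · simp [hu, quadForm]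
    by_cases hv : v = 0
    · simp [hv, quadForm]
    exact (div_le_iff₀ (hpos hu hv)).1 (hall u v hu hv)

/-- The Stein-type equation `Z = -∑ᵢ Bᵢ* Z Cᵢ` has only the trivial solution if `B` and `C` are
strictly contractive for some positive definite forms. -/
theorem eq_zero_of_stein {X Y Z : Matrix ι ι ℂ} {B C : κ → Matrix ι ι ℂ} (hX : X.PosDef)
    (hY : Y.PosDef) (hB : (X - ∑ i, (B i)ᴴ * X * B i).PosDef)
    (hC : (Y - ∑ i, (C i)ᴴ * Y * C i).PosDef) (hZ : Z = -∑ i, (B i)ᴴ * Z * C i) : Z = 0 := by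
  by_contra hne
  obtain ⟨M, hM, u, hu, v, hv, heq, hle⟩ := exists_extremal_pair hX hY hne
  have hBu := quadForm_pos hB hu
  have hCv := quadForm_pos hC hv
  simp only [quadForm_sub, quadForm_sum, quadForm_conjugate, sub_pos] at hBu hCv
  -- At the extremal pair, substitute the equation, bound each term by extremality and apply
  -- Cauchy–Schwarz over `i`. The two strict contractions then give `M * (quadForm X u * quadForm Y
  -- v)` strictly less than itself.
  have hs : ‖star u ⬝ᵥ Z *ᵥ v‖ ≤
      ∑ i, √(quadForm X (B i *ᵥ u)) * (√M * √(quadForm Y (C i *ᵥ v))) := by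
    conv_lhs => rw [hZ]
    rw [Matrix.neg_mulVec, dotProduct_neg, norm_neg, Matrix.sum_mulVec, dotProduct_sum]
    refine (norm_sum_le _ _).trans (Finset.sum_le_sum fun i _ => ?_)
    rw [star_dotProduct_conjugate_mulVec]
    refine (Real.le_sqrt_of_sq_le (hle _ _)).trans_eq ?_
    rw [Real.sqrt_mul hM.le, Real.sqrt_mul (quadForm_nonneg hX.posSemidef _)]
    ring
  have hcs := Finset.sum_mul_sq_le_sq_mul_sq Finset.univ (fun i => √(quadForm X (B i *ᵥ u)))
    (fun i => √M * √(quadForm Y (C i *ᵥ v)))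
  simp only [mul_pow, Real.sq_sqrt hM.le, Real.sq_sqrt (quadForm_nonneg hX.posSemidef _),
    Real.sq_sqrt (quadForm_nonneg hY.posSemidef _), ← Finset.mul_sum] at hcs
  have h1 : ‖star u ⬝ᵥ Z *ᵥ v‖ ^ 2 ≤ (∑ i, quadForm X (B i *ᵥ u)) *
      (M * ∑ i, quadForm Y (C i *ᵥ v)) :=
    (pow_le_pow_left₀ (norm_nonneg _) hs 2).trans hcs
  have h2 : (∑ i, quadForm X (B i *ᵥ u)) * (∑ i, quadForm Y (C i *ᵥ v)) <
      quadForm X u * quadForm Y v :=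
    mul_lt_mul'' hBu hCv (Finset.sum_nonneg fun i _ => quadForm_nonneg hX.posSemidef _)
      (Finset.sum_nonneg fun i _ => quadForm_nonneg hY.posSemidef _)
  have h3 := mul_lt_mul_of_pos_left h2 hM
  linarith

end Stein

/-! ### Uniqueness of the solution and invertibility of `L`. -/

section Equation

variable {m n : ℕ} {A : Fin m → Matrix (Fin n) (Fin n) ℂ} {Q X Y : Matrix (Fin n) (Fin n) ℂ}

theorem conjTranspose_matB (hX : X.IsHermitian) (i : Fin m) :
    (matB A X i)ᴴ = (A i)ᴴ * X⁻¹ := by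
  rw [matB, Matrix.conjTranspose_mul, Matrix.conjTranspose_nonsing_inv, hX.eq]

theorem conjTranspose_matB_mul_mul_matB (hX : X.PosDef) (i : Fin m) :
    (matB A X i)ᴴ * X * matB A X i = (A i)ᴴ * X⁻¹ * A i := by
  have hdet : IsUnit X.det := X.isUnit_iff_isUnit_det.1 hX.isUnit
  rw [conjTranspose_matB hX.isHermitian, matB, Matrix.nonsing_inv_mul_cancel_right _ _ hdet,
    Matrix.mul_assoc]

/-- Since `Bᵢ* X Bᵢ = Aᵢ* X⁻¹ Aᵢ`, positivity of `Q` becomes the strict contractivity required by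
`eq_zero_of_stein`. -/
theorem IsPosDefSolution.stein (h : IsPosDefSolution A Q X) :
    X - ∑ i, (matB A X i)ᴴ * X * matB A X i = Q := by
  simp_rw [conjTranspose_matB_mul_mul_matB h.1]
  exact h.2

/-- The identity `X⁻¹ - Y⁻¹ = X⁻¹ (Y - X) Y⁻¹` makes `X - Y` solve a Stein equation with different
left and right families, which is why `eq_zero_of_stein` admits both `B` and `C`. -/
theorem IsPosDefSolution.unique (hQ : Q.PosDef) (hX : IsPosDefSolution A Q X)
    (hY : IsPosDefSolution A Q Y) : X = Y := by
  refine sub_eq_zero.1 (eq_zero_of_stein (B := matB A X) (C := matB A Y) hX.1 hY.1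
    (by rwa [hX.stein]) (by rwa [hY.stein]) ?_)
  have h : ∀ i, (matB A X i)ᴴ * (X - Y) * matB A Y i =
      (A i)ᴴ * Y⁻¹ * A i - (A i)ᴴ * X⁻¹ * A i := by
    intro i
    rw [conjTranspose_matB hX.1.isHermitian, matB, ← Matrix.sub_mul, ← Matrix.mul_sub,
      ← neg_sub X⁻¹, Matrix.inv_sub_inv (by simp [hX.1.isUnit, hY.1.isUnit]), ← neg_sub Y X]
    simp only [Matrix.mul_assoc, Matrix.mul_neg, Matrix.neg_mul]
  simp_rw [h]
  rw [Finset.sum_sub_distrib]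
  have h1 := hX.2
  have h2 := hY.2
  rw [sub_eq_iff_eq_add] at h1 h2
  nth_rw 1 [h1, h2]
  abel

/-- The operator `Z ↦ Z + ∑ᵢ Bᵢ* Z Bᵢ`. -/
def steinMap (B : Fin m → Matrix (Fin n) (Fin n) ℂ) :
    Matrix (Fin n) (Fin n) ℂ →ₗ[ℂ] Matrix (Fin n) (Fin n) ℂ where
  toFun Z := Z + ∑ i, (B i)ᴴ * Z * B i
  map_add' Z W := by
    simp only [Matrix.mul_add, Matrix.add_mul, Finset.sum_add_distrib]
    abel
  map_smul' c Z := by simp [Finset.smul_sum]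

theorem steinMap_apply (B : Fin m → Matrix (Fin n) (Fin n) ℂ) (Z : Matrix (Fin n) (Fin n) ℂ) :
    steinMap B Z = Z + ∑ i, (B i)ᴴ * Z * B i :=
  rfl

theorem steinMap_conjTranspose (B : Fin m → Matrix (Fin n) (Fin n) ℂ)
    (Z : Matrix (Fin n) (Fin n) ℂ) : steinMap B Zᴴ = (steinMap B Z)ᴴ := by
  simp [steinMap_apply, Matrix.conjTranspose_sum, Matrix.mul_assoc]

theorem IsPosDefSolution.steinMap_injective (hQ : Q.PosDef) (hX : IsPosDefSolution A Q X) :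
    Function.Injective (steinMap (matB A X)) := by
  refine (injective_iff_map_eq_zero _).2 fun Z hZ => ?_
  exact eq_zero_of_stein hX.1 hX.1 (by rwa [hX.stein]) (by rwa [hX.stein])
    (eq_neg_of_add_eq_zero_left hZ)

theorem matL_mulVec_vec (Z : Matrix (Fin n) (Fin n) ℂ) :
    matL A X *ᵥ Z.vec = (steinMap (matB A X) Z).vec := by
  simp [matL, steinMap_apply, Matrix.add_mulVec, Matrix.sum_mulVec, Matrix.kronecker_mulVec_vec,
    Matrix.vec_sum]

theorem IsPosDefSolution.isUnit_matL (hQ : Q.PosDef) (hX : IsPosDefSolution A Q X) :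
    IsUnit (matL A X) := by
  refine Matrix.mulVec_injective_iff_isUnit.1 fun x y hxy => ?_
  obtain ⟨Z, rfl⟩ := Matrix.vec_bijective.surjective x
  obtain ⟨W, rfl⟩ := Matrix.vec_bijective.surjective y
  simp only [matL_mulVec_vec, Matrix.vec_inj] at hxy
  rw [hX.steinMap_injective hQ hxy]

end Equation

/-! ### The inverse function theorem for the equation. -/

section StarAlgebra

variable {κ R : Type*} [Fintype κ] [NormedRing R] [NormedAlgebra ℝ R] [StarRing R]

/-- The map `(A, X) ↦ (A, X - ∑ᵢ Aᵢ* X⁻¹ Aᵢ)` on a star ring. -/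
def equationMap (p : (κ → R) × R) : (κ → R) × R :=
  (p.1, p.2 - ∑ i, star (p.1 i) * Ring.inverse p.2 * p.1 i)

variable [StarModule ℝ R]

/-- The map `(E, Z) ↦ (E, Z + ∑ᵢ Bᵢ* Z Bᵢ - ∑ᵢ (Eᵢ* Bᵢ + Bᵢ* Eᵢ))`, which is the derivative of
`equationMap` at `(A, X)` if `X` is self-adjoint and `Bᵢ = X⁻¹ Aᵢ`. -/
def equationDeriv (B : κ → R) : (κ → R) × R →ₗ[ℝ] (κ → R) × R where
  toFun p := (p.1, p.2 + ∑ i, star (B i) * p.2 * B i -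
    ∑ i, (star (p.1 i) * B i + star (B i) * p.1 i))
  map_add' p q := by
    refine Prod.ext rfl ?_
    simp only [Prod.fst_add, Prod.snd_add, Pi.add_apply, star_add, mul_add, add_mul,
      Finset.sum_add_distrib]
    abel
  map_smul' c p := by
    refine Prod.ext rfl ?_
    simp [Finset.smul_sum, smul_sub, smul_add]

variable [FiniteDimensional ℝ R] [ContinuousStar R]

theorem hasStrictFDerivAt_equationMap (A : κ → R) (x : Rˣ) (hx : star (x : R) = x) :
    HasStrictFDerivAt equationMap
      (equationDeriv fun i => (↑x⁻¹ : R) * A i).toContinuousLinearMap (A, (x : R)) := by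
  have : CompleteSpace R := FiniteDimensional.complete ℝ R
  have hinv := (hasStrictFDerivAt_ringInverse (𝕜 := ℝ) x).comp (A, (x : R))
    (hasStrictFDerivAt_snd (𝕜 := ℝ) (p := (A, (x : R))))
  have hfst := fun i => (hasStrictFDerivAt_apply (𝕜 := ℝ) i A).comp (A, (x : R))
    (hasStrictFDerivAt_fst (𝕜 := ℝ) (p := (A, (x : R))))
  have hterm := fun i => ((hfst i).star.mul' hinv).mul' (hfst i)
  have h := (hasStrictFDerivAt_fst (𝕜 := ℝ) (p := (A, (x : R)))).prodMk
    ((hasStrictFDerivAt_snd (𝕜 := ℝ) (p := (A, (x : R)))).sub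
      (HasStrictFDerivAt.fun_sum fun i (_ : i ∈ Finset.univ) => hterm i))
  refine h.congr_fderiv (ContinuousLinearMap.ext ?_)
  rintro ⟨E, Z⟩
  have hxi : star (↑x⁻¹ : R) = ↑x⁻¹ := by
    have : star x = x := Units.ext hx
    rw [← Units.coe_star_inv, this]
  refine Prod.ext (by simp [equationDeriv]) ?_
  simp [equationDeriv, hxi, mul_assoc, Finset.sum_add_distrib]
  abel

/-- Carrying `A` along as a coordinate turns the implicit function problem into an inverse function
problem. In finite dimension, injectivity of the derivative is enough. Scalars are real because
`star` is only conjugate-linear. -/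
theorem exists_local_solution_equationMap (A : κ → R) (x : Rˣ) (hx : star (x : R) = x) {Q : R}
    (hQ : (x : R) - ∑ i, star (A i) * ↑x⁻¹ * A i = Q)
    (hinj : Function.Injective fun Z : R =>
      Z + ∑ i, star (↑x⁻¹ * A i) * Z * (↑x⁻¹ * A i)) :
    ∃ (φ : (κ → R) × R → R) (T : (κ → R) × R →L[ℝ] R),
      φ (A, Q) = x ∧ HasFDerivAt φ T (A, Q) ∧
      (∀ E F, T (E, F) + ∑ i, star (↑x⁻¹ * A i) * T (E, F) * (↑x⁻¹ * A i) =
        F + ∑ i, (star (E i) * (↑x⁻¹ * A i) + star (↑x⁻¹ * A i) * E i)) ∧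
      ∀ᶠ p in 𝓝 (A, Q), star p.2 = p.2 →
        star (φ p) = φ p ∧ φ p - ∑ i, star (p.1 i) * Ring.inverse (φ p) * p.1 i = p.2 := by
  have : CompleteSpace R := FiniteDimensional.complete ℝ R
  have hinj' : Function.Injective (equationDeriv fun i => (↑x⁻¹ : R) * A i) := by
    rintro ⟨E, Z⟩ ⟨E', Z'⟩ h
    obtain ⟨rfl, h⟩ := Prod.mk.inj h
    exact Prod.ext rfl (hinj (sub_left_injective h))
  let e : ((κ → R) × R) ≃L[ℝ] (κ → R) × R :=
    (LinearEquiv.ofInjectiveEndo _ hinj').toContinuousLinearEquiv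
  have he : HasStrictFDerivAt equationMap (e : (κ → R) × R →L[ℝ] (κ → R) × R) (A, (x : R)) :=
    (hasStrictFDerivAt_equationMap A x hx).congr_fderiv (ContinuousLinearMap.ext fun p => rfl)
  have hAQ : equationMap (A, (x : R)) = (A, Q) := by simp [equationMap, ← hQ]
  have hg0 : he.localInverse equationMap e (A, (x : R)) (A, Q) = (A, (x : R)) := by
    rw [← hAQ, he.localInverse_apply_image]
  have hd := he.to_localInverse
  have hr := he.eventually_right_inverse
  have hl := he.eventually_left_inverse
  rw [hAQ] at hd hr
  set g := he.localInverse equationMap e (A, (x : R))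
  have hgc : Tendsto (fun p => (g p).2) (𝓝 (A, Q)) (𝓝 (x : R)) := by
    have := (continuous_snd.tendsto _).comp hd.continuousAt.tendsto
    rwa [hg0] at this
  refine ⟨fun p => (g p).2, ContinuousLinearMap.snd ℝ _ _ ∘L
    (e.symm : (κ → R) × R →L[ℝ] (κ → R) × R), ?_, ?_, ?_, ?_⟩
  · simp [hg0]
  · exact (ContinuousLinearMap.snd ℝ _ _).hasFDerivAt.comp _ hd.hasFDerivAt
  · intro E F
    have h1 : equationDeriv (fun i => (↑x⁻¹ : R) * A i) (e.symm (E, F)) = (E, F) :=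
      e.apply_symm_apply (E, F)
    have h2 : (e.symm (E, F)).1 = E := congrArg Prod.fst h1
    have h3 := congrArg Prod.snd h1
    simp only [equationDeriv, LinearMap.coe_mk, AddHom.coe_mk, sub_eq_iff_eq_add] at h3
    rw [h2] at h3
    exact h3
  -- For self-adjoint `p.2`, the adjoint of the local solution solves the same equation and is still
  -- near `x`. The left inverse property therefore identifies the two.
  · have hconj : Tendsto (fun p : (κ → R) × R => (p.1, star (g p).2)) (𝓝 (A, Q))
        (𝓝 (A, (x : R))) := by
      refine (continuous_fst.tendsto _).prodMk_nhds ?_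
      have := (continuous_star.tendsto (x : R)).comp hgc
      rwa [hx] at this
    filter_upwards [hr, hconj.eventually hl] with p hp1 hp2 hp
    have h1 : (equationMap (g p)).1 = p.1 := congrArg Prod.fst hp1
    change (g p).1 = p.1 at h1
    have h2 : (g p).2 - ∑ i, star (p.1 i) * Ring.inverse (g p).2 * p.1 i = p.2 := by
      have h := congrArg Prod.snd hp1
      rwa [equationMap, h1] at h
    have h3 : equationMap (p.1, star (g p).2) = p := by
      refine Prod.ext rfl ?_
      rw [← hp, ← h2]
      simp [equationMap, mul_assoc, Ring.inverse_star]
    rw [h3] at hp2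
    exact ⟨(congrArg Prod.snd hp2).symm, h2⟩

end StarAlgebra

/-! ### The local branch of positive definite solutions. -/

section LocalSolution

open scoped Matrix.Norms.Frobenius

variable {m n : ℕ}

theorem IsPosDefSolution.exists_local_solution {A : Fin m → Matrix (Fin n) (Fin n) ℂ}
    {Q X : Matrix (Fin n) (Fin n) ℂ} (hQ : Q.PosDef) (hX : IsPosDefSolution A Q X) :
    ∃ (φ : (Fin m → Matrix (Fin n) (Fin n) ℂ) × Matrix (Fin n) (Fin n) ℂ →
        Matrix (Fin n) (Fin n) ℂ)
      (T : (Fin m → Matrix (Fin n) (Fin n) ℂ) × Matrix (Fin n) (Fin n) ℂ →ₗ[ℝ]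
        Matrix (Fin n) (Fin n) ℂ),
      (∀ ε > 0, ∃ r > 0, ∀ E F, ‖(E, F)‖ < r →
        ‖φ (A + E, Q + F) - X - T (E, F)‖ ≤ ε * ‖(E, F)‖) ∧
      (∀ E F, steinMap (matB A X) (T (E, F)) =
        F + ∑ i, ((E i)ᴴ * matB A X i + (matB A X i)ᴴ * E i)) ∧
      ∃ r > 0, ∀ E F, ‖(E, F)‖ < r → F.IsHermitian →
        (Q + F).PosDef ∧ IsPosDefSolution (A + E) (Q + F) (φ (A + E, Q + F)) := by
  obtain ⟨x, hx⟩ := hX.1.isUnit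
  have hxi : ((x⁻¹ : (Matrix (Fin n) (Fin n) ℂ)ˣ) : Matrix (Fin n) (Fin n) ℂ) = X⁻¹ := by
    rw [← hx, Matrix.coe_units_inv]
  obtain ⟨φ, T, h0, hd, hT, hev⟩ := exists_local_solution_equationMap A x (Q := Q)
    (by rw [hx]; exact hX.1.isHermitian) (by rw [hx, hxi]; exact hX.2)
    (by rw [hxi]; exact hX.steinMap_injective hQ)
  rw [hx] at h0
  simp only [hxi] at hT
  refine ⟨φ, T, fun ε hε => ?_, hT, ?_⟩
  · obtain ⟨r, hr, h⟩ := Metric.eventually_nhds_iff.1 (hd.isLittleO.def hε)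
    refine ⟨r, hr, fun E F hEF => ?_⟩
    have h1 := @h (A + E, Q + F) (by simpa [dist_eq_norm] using hEF)
    simpa [h0] using h1
  · have hcont : Tendsto φ (𝓝 (A, Q)) (𝓝 X) := by
      have := hd.continuousAt.tendsto
      rw [h0] at this
      exact this
    have hQev := (continuous_snd.tendsto (A, Q)).eventually (eventually_posDef hQ)
    obtain ⟨r, hr, h⟩ := Metric.eventually_nhds_iff.1
      (hev.and ((hcont.eventually (eventually_posDef hX.1)).and hQev))
    refine ⟨r, hr, fun E F hEF hF => ?_⟩
    obtain ⟨h1, h2, h3⟩ := @h (A + E, Q + F) (by simpa [dist_eq_norm] using hEF)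
    have hQF : (Q + F).IsHermitian := hQ.isHermitian.add hF
    obtain ⟨h4, h5⟩ := h1 hQF
    refine ⟨h3 hQF, h2 h4, ?_⟩
    simp only [Matrix.nonsing_inv_eq_ringInverse]
    exact h5

end LocalSolution

/-! ### Existence by continuation. -/

section Existence

theorem exists_sub_smul_one_posDef {ι : Type*} [Fintype ι] [DecidableEq ι] {Q : Matrix ι ι ℂ}
    (hQ : Q.PosDef) : ∃ c : ℝ, 0 < c ∧ (Q - c • (1 : Matrix ι ι ℂ)).PosDef := by
  have ht : Tendsto (fun c : ℝ => Q - c • (1 : Matrix ι ι ℂ)) (𝓝[>] 0) (𝓝 Q) := by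
    have : Continuous fun c : ℝ => Q - c • (1 : Matrix ι ι ℂ) := by fun_prop
    simpa using (this.tendsto 0).mono_left nhdsWithin_le_nhds
  obtain ⟨c, hc, hc0⟩ := ((ht.eventually (eventually_posDef hQ)).and self_mem_nhdsWithin).exists
  refine ⟨c, hc0, hc (hQ.isHermitian.sub ?_)⟩
  simp [Matrix.IsHermitian]

theorem quadForm_smul_one {ι : Type*} [Fintype ι] [DecidableEq ι] (c : ℝ) (u : ι → ℂ) :
    quadForm (c • (1 : Matrix ι ι ℂ)) u = c * ∑ i, ‖u i‖ ^ 2 := by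
  rw [quadForm, Matrix.smul_mulVec, Matrix.one_mulVec, dotProduct_smul, Complex.smul_re,
    smul_eq_mul, dotProduct, Complex.re_sum]
  congr 1
  refine Finset.sum_congr rfl fun i _ => ?_
  rw [Pi.star_apply, Complex.star_def, ← Complex.normSq_eq_conj_mul_self, Complex.ofReal_re,
    Complex.normSq_eq_norm_sq]

/-- Inverses of matrices above a fixed positive definite matrix are uniformly bounded. -/
theorem exists_bound_inverse {ι : Type*} [Fintype ι] [DecidableEq ι] {Q : Matrix ι ι ℂ}
    (hQ : Q.PosDef) : ∃ C : ℝ, ∀ X W : Matrix ι ι ℂ, (X - Q).PosSemidef → W.IsHermitian →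
      X * W = 1 → ∀ i j, ‖W i j‖ ≤ C := by
  obtain ⟨c, hc, hQc⟩ := exists_sub_smul_one_posDef hQ
  refine ⟨c⁻¹, fun X W hXQ hW hXW i j => ?_⟩
  have hq : c * ∑ k, ‖W k j‖ ^ 2 ≤ (W j j).re := by
    -- Test `X - c • 1 ≥ 0` on the `j`-th column of `W`; because `W X W = W`, the `X` term is just
    -- the diagonal entry `W j j`.
    have h1 := quadForm_nonneg (hXQ.add hQc.posSemidef) (W *ᵥ Pi.single j 1)
    rw [sub_add_sub_cancel, quadForm_sub, quadForm_smul_one, ← quadForm_conjugate, Matrix.mul_assoc,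
      hXW, Matrix.mul_one, hW.eq] at h1
    simpa [quadForm, dotProduct, Pi.single_apply, apply_ite] using h1
  have hterm : ∀ k, ‖W k j‖ ^ 2 ≤ ∑ k, ‖W k j‖ ^ 2 := fun k =>
    Finset.single_le_sum (f := fun k => ‖W k j‖ ^ 2) (fun _ _ => by positivity) (Finset.mem_univ k)
  have hle : ∀ k, c * ‖W k j‖ ^ 2 ≤ ‖W j j‖ := fun k =>
    ((mul_le_mul_of_nonneg_left (hterm k) hc.le).trans hq).trans (Complex.re_le_norm _)
  have hjj : ‖W j j‖ ≤ c⁻¹ := by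
    rw [← one_div, le_div_iff₀ hc]
    by_contra! h
    nlinarith [hle j, norm_nonneg (W j j)]
  refine le_of_sq_le_sq ?_ (by positivity)
  calc ‖W i j‖ ^ 2 = c⁻¹ * (c * ‖W i j‖ ^ 2) := by field_simp
    _ ≤ c⁻¹ * c⁻¹ := mul_le_mul_of_nonneg_left ((hle i).trans hjj) (by positivity)
    _ = c⁻¹ ^ 2 := by ring

variable {m n : ℕ} {Q : Matrix (Fin n) (Fin n) ℂ}

/-- In the unknown `W = X⁻¹` the problem reads `F (s, W) * W = 1` with `W` positive semidefinite.
These conditions are closed, and `exists_bound_inverse` confines `W` to a compact set, so the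
solvable `s` are the projection of a compact set. -/
theorem isClosed_setOf_scaled_solvable (A : Fin m → Matrix (Fin n) (Fin n) ℂ) (hQ : Q.PosDef) :
    IsClosed ({s : ℝ | ∃ X, IsPosDefSolution (s • A) Q X} ∩ Set.Icc 0 1) := by
  obtain ⟨C, hC⟩ := exists_bound_inverse hQ
  let F : ℝ × Matrix (Fin n) (Fin n) ℂ → Matrix (Fin n) (Fin n) ℂ := fun p =>
    Q + ∑ i, (p.1 • A i)ᴴ * p.2 * (p.1 • A i)
  have hF : Continuous F := by fun_prop
  let B : Set (Matrix (Fin n) (Fin n) ℂ) :=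
    Set.univ.pi fun _ => Set.univ.pi fun _ => Metric.closedBall 0 C
  have hB : IsCompact B :=
    isCompact_univ_pi fun _ => isCompact_univ_pi fun _ => isCompact_closedBall _ _
  have hK : IsCompact ((Set.Icc 0 1 ×ˢ B) ∩
      ({p | F p * p.2 = 1} ∩ Prod.snd ⁻¹' {W | W.PosSemidef})) := by
    refine (isCompact_Icc.prod hB).inter_right (IsClosed.inter ?_ ?_)
    · exact isClosed_eq (hF.mul continuous_snd) continuous_const
    · exact posSemidef_isClosed.preimage continuous_snd
  convert (hK.image continuous_fst).isClosed using 1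
  ext s
  simp only [Set.mem_inter_iff, Set.mem_ofPred_eq, Set.mem_image, Prod.exists, exists_and_right,
    exists_eq_right, Set.mem_prod, Set.mem_preimage]
  constructor
  · rintro ⟨⟨X, hX⟩, hs⟩
    have hdet : IsUnit X.det := X.isUnit_iff_isUnit_det.1 hX.1.isUnit
    have hFX : F (s, X⁻¹) = X := (sub_eq_iff_eq_add.1 hX.2).symm
    have hXX : X * X⁻¹ = 1 := Matrix.mul_nonsing_inv _ hdet
    have hXi : X⁻¹.PosSemidef := hX.1.inv.posSemidef
    refine ⟨X⁻¹, ⟨hs, ?_⟩, by rw [hFX, hXX], hXi⟩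
    have hXQ : (X - Q).PosSemidef := by
      rw [sub_eq_iff_eq_add'.2 hFX.symm]
      exact Matrix.posSemidef_sum _ fun i _ => hXi.conjTranspose_mul_mul_same _
    intro i _ j _
    simpa using hC X X⁻¹ hXQ hXi.isHermitian hXX i j
  · rintro ⟨W, ⟨hs, -⟩, hFW, hW⟩
    refine ⟨⟨F (s, W), ?_, ?_⟩, hs⟩
    · exact hQ.add_posSemidef (Matrix.posSemidef_sum _ fun i _ => hW.conjTranspose_mul_mul_same _)
    · rw [Matrix.inv_eq_right_inv hFW]
      exact add_sub_cancel_right _ _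

open scoped Matrix.Norms.Frobenius in
theorem exists_isPosDefSolution (A : Fin m → Matrix (Fin n) (Fin n) ℂ) (hQ : Q.PosDef) :
    ∃ X, IsPosDefSolution A Q X := by
  have h1 : (1 : ℝ) ∈ {s : ℝ | ∃ X, IsPosDefSolution (s • A) Q X} := by
    -- At `s = 0` the solution is `Q`; the local branch at a solvable `s < 1` supplies a larger
    -- solvable `t ≤ 1`.
    refine (isClosed_setOf_scaled_solvable A hQ).mem_of_ge_of_forall_exists_gt
      ⟨Q, hQ, by simp⟩ zero_le_one ?_
    rintro s ⟨⟨X, hX⟩, hs⟩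
    obtain ⟨φ, T, -, -, r, hr, h⟩ := hX.exists_local_solution hQ
    have ht : Tendsto (fun t : ℝ => ‖((t - s) • A, (0 : Matrix (Fin n) (Fin n) ℂ))‖)
        (𝓝[>] s) (𝓝 0) := by
      have : Tendsto (fun t : ℝ => |t - s| * ‖(A, (0 : Matrix (Fin n) (Fin n) ℂ))‖)
          (𝓝[>] s) (𝓝 0) := by
        have : Continuous fun t : ℝ => |t - s| * ‖(A, (0 : Matrix (Fin n) (Fin n) ℂ))‖ := by
          fun_prop
        simpa using (this.tendsto s).mono_left nhdsWithin_le_nhds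
      refine this.congr fun t => ?_
      rw [← Real.norm_eq_abs, ← norm_smul, Prod.smul_mk, smul_zero]
    obtain ⟨t, htr, hts⟩ := ((ht.eventually_lt_const hr).and
      (Ioc_mem_nhdsGT hs.2)).exists
    have h2 := (h _ _ htr Matrix.isHermitian_zero).2
    rw [← add_smul, add_sub_cancel, add_zero] at h2
    exact ⟨t, ⟨_, h2⟩, hts⟩
  simpa using h1

end Existence

/-! ### Frobenius norms and the Hermitian splitting. -/

section FrobeniusNorm

theorem frobNorm_nonneg {r c : Type*} [Fintype r] [Fintype c] (M : Matrix r c ℂ) :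
    0 ≤ frobNorm M := by
  open scoped Matrix.Norms.Frobenius in exact norm_nonneg M

theorem frobNorm_sq {r c : Type*} [Fintype r] [Fintype c] (M : Matrix r c ℂ) :
    frobNorm M ^ 2 = ∑ i, ∑ j, ‖M i j‖ ^ 2 := by
  rw [frobNorm, Matrix.frobenius_norm_def, ← Real.sqrt_eq_rpow, Real.sq_sqrt (by positivity)]
  norm_cast

theorem frobNorm_conjTranspose {r c : Type*} [Fintype r] [Fintype c] (M : Matrix r c ℂ) :
    frobNorm Mᴴ = frobNorm M :=
  Matrix.frobenius_norm_conjTranspose M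

theorem frobNorm_smul {r c : Type*} [Fintype r] [Fintype c] (t : ℝ) (M : Matrix r c ℂ) :
    frobNorm (t • M) = |t| * frobNorm M := by
  open scoped Matrix.Norms.Frobenius in exact norm_smul t M

/-- The Hermitian and skew-Hermitian parts of a matrix are orthogonal. -/
theorem frobNorm_add_I_smul_sq {ι : Type*} [Fintype ι] {H G : Matrix ι ι ℂ} (hH : H.IsHermitian)
    (hG : G.IsHermitian) :
    frobNorm (H + Complex.I • G) ^ 2 = frobNorm H ^ 2 + frobNorm G ^ 2 := by
  have h1 : frobNorm (H + Complex.I • G) ^ 2 = frobNorm (H - Complex.I • G) ^ 2 := by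
    rw [← frobNorm_conjTranspose, Matrix.conjTranspose_add, Matrix.conjTranspose_smul, hH.eq, hG.eq,
      Complex.star_def, Complex.conj_I, neg_smul, ← sub_eq_add_neg]
  have h2 : frobNorm (H + Complex.I • G) ^ 2 + frobNorm (H - Complex.I • G) ^ 2 =
      2 * (frobNorm H ^ 2 + frobNorm G ^ 2) := by
    simp only [frobNorm_sq, ← Finset.sum_add_distrib, Finset.mul_sum]
    refine Finset.sum_congr rfl fun i _ => Finset.sum_congr rfl fun j _ => ?_
    have h := parallelogram_law_with_norm ℝ (H i j) (Complex.I * G i j)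
    rw [norm_mul, Complex.norm_I, one_mul] at h
    simp only [Matrix.add_apply, Matrix.sub_apply, Matrix.smul_apply, smul_eq_mul]
    exact h
  linarith

theorem exists_hermitian_add_I_smul {ι : Type*} (F : Matrix ι ι ℂ) :
    ∃ H G : Matrix ι ι ℂ, H.IsHermitian ∧ G.IsHermitian ∧ F = H + Complex.I • G := by
  refine ⟨realPart F, imaginaryPart F, (realPart F).2, (imaginaryPart F).2, ?_⟩
  exact (realPart_add_I_smul_imaginaryPart F).symm

variable {m n : ℕ} (η : Fin m → ℝ) (ρ : ℝ)

theorem perturbationNorm_nonneg (E : Fin m → Matrix (Fin n) (Fin n) ℂ)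
    (F : Matrix (Fin n) (Fin n) ℂ) : 0 ≤ perturbationNorm η ρ E F :=
  frobNorm_nonneg _

theorem perturbationNorm_sq (E : Fin m → Matrix (Fin n) (Fin n) ℂ)
    (F : Matrix (Fin n) (Fin n) ℂ) :
    perturbationNorm η ρ E F ^ 2 =
      ∑ i, frobNorm ((η i)⁻¹ • E i) ^ 2 + frobNorm (ρ⁻¹ • F) ^ 2 := by
  simp only [perturbationNorm, frobNorm_sq, Fintype.sum_sum_type, Finset.sum_add_distrib,
    Matrix.fromCols_apply_inl, Matrix.fromCols_apply_inr, Fintype.sum_prod_type]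
  rw [Finset.sum_comm]
  rfl

theorem perturbationNorm_smul (t : ℝ) (E : Fin m → Matrix (Fin n) (Fin n) ℂ)
    (F : Matrix (Fin n) (Fin n) ℂ) :
    perturbationNorm η ρ (t • E) (t • F) = |t| * perturbationNorm η ρ E F := by
  rw [perturbationNorm, perturbationNorm, ← frobNorm_smul]
  congr 1
  ext i (j | j) <;> simp [blockRow, mul_left_comm]

end FrobeniusNorm

/-! ### Real matrices of real-linear maps. -/

section Realification

variable {ι κ : Type*}

/-- A complex vector as the real vector of its real and imaginary parts. -/
def realify (v : ι → ℂ) : ι ⊕ ι → ℝ := Sum.elim (fun i => (v i).re) fun i => (v i).im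

theorem realify_surjective : Function.Surjective (realify : (ι → ℂ) → ι ⊕ ι → ℝ) := by
  intro w
  refine ⟨fun i => ⟨w (.inl i), w (.inr i)⟩, ?_⟩
  ext (i | i) <;> rfl

theorem realify_add (v w : ι → ℂ) : realify (v + w) = realify v + realify w := by
  ext (i | i) <;> simp [realify]

theorem realify_smul (t : ℝ) (v : ι → ℂ) : realify (t • v) = t • realify v := by
  ext (i | i) <;> simp [realify]

theorem realify_sum (s : Finset κ) (v : κ → ι → ℂ) :
    realify (∑ k ∈ s, v k) = ∑ k ∈ s, realify (v k) := by
  ext (i | i) <;> simp [realify, Finset.sum_apply]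

theorem sum_sq_realify [Fintype ι] (v : ι → ℂ) :
    ∑ i, realify v i ^ 2 = ∑ i, ‖v i‖ ^ 2 := by
  simp only [Fintype.sum_sum_type, realify, Sum.elim_inl, Sum.elim_inr, ← Finset.sum_add_distrib,
    Complex.sq_norm, Complex.normSq_apply, ← sq]

theorem sum_sq_realify_vec {r c : Type*} [Fintype r] [Fintype c] (M : Matrix r c ℂ) :
    ∑ i, realify M.vec i ^ 2 = frobNorm M ^ 2 := by
  rw [sum_sq_realify, frobNorm_sq, Fintype.sum_prod_type, Finset.sum_comm]
  rfl

/-- This explains the sign pattern of `Uᵢ`: every real-linear map is a complex-linear part `P` plus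
a conjugate-linear part `R`. The case `R = 0` gives `S_c`. -/
theorem fromBlocks_mulVec_realify [Fintype ι] (P R : Matrix ι ι ℂ) (v : ι → ℂ) :
    Matrix.fromBlocks (rePart P + rePart R) (imPart R - imPart P) (imPart P + imPart R)
      (rePart P - rePart R) *ᵥ realify v = realify (P *ᵥ v + R *ᵥ star v) := by
  ext (i | i)
  · simp only [Matrix.mulVec, dotProduct, Fintype.sum_sum_type, realify, Matrix.fromBlocks_apply₁₁,
      Matrix.fromBlocks_apply₁₂, Sum.elim_inl, Sum.elim_inr, Pi.add_apply, Complex.add_re,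
      Complex.re_sum, ← Finset.sum_add_distrib]
    refine Finset.sum_congr rfl fun j _ => ?_
    simp [rePart, imPart]
    ring
  · simp only [Matrix.mulVec, dotProduct, Fintype.sum_sum_type, realify, Matrix.fromBlocks_apply₂₁,
      Matrix.fromBlocks_apply₂₂, Sum.elim_inl, Sum.elim_inr, Pi.add_apply, Complex.add_im,
      Complex.im_sum, ← Finset.sum_add_distrib]
    refine Finset.sum_congr rfl fun j _ => ?_
    simp [rePart, imPart]
    ring

end Realification

/-! ### The stacked matrix as the first-order solution operator. -/

section SpectralNorm

theorem specNorm_nonneg {r c : Type*} [Fintype r] [Fintype c] [DecidableEq c]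
    (M : Matrix r c ℝ) : 0 ≤ specNorm M := by
  open scoped Matrix.Norms.L2Operator in exact norm_nonneg M

theorem norm_mulVec_le_specNorm_mul {r c : Type*} [Fintype r] [Fintype c] [DecidableEq c]
    (M : Matrix r c ℝ) (w : c → ℝ) :
    ‖WithLp.toLp 2 (M *ᵥ w)‖ ≤ specNorm M * ‖WithLp.toLp 2 w‖ :=
  Matrix.l2_opNorm_mulVec M (WithLp.toLp 2 w)

theorem specNorm_le_of_forall {r c : Type*} [Fintype r] [Fintype c] [DecidableEq c]
    {M : Matrix r c ℝ} {K : ℝ} (hK : 0 ≤ K)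
    (h : ∀ w : c → ℝ, ‖WithLp.toLp 2 (M *ᵥ w)‖ ≤ K * ‖WithLp.toLp 2 w‖) : specNorm M ≤ K :=
  ContinuousLinearMap.opNorm_le_bound _ hK fun w => h w.ofLp

variable {m n : ℕ} {A : Fin m → Matrix (Fin n) (Fin n) ℂ} {Q X : Matrix (Fin n) (Fin n) ℂ}

/-- The matrix `(ρ S_c, η₁ U₁, …, ηₘ Uₘ)`. -/
abbrev condMatrix (η : Fin m → ℝ) (ρ : ℝ) (A : Fin m → Matrix (Fin n) (Fin n) ℂ)
    (X : Matrix (Fin n) (Fin n) ℂ) :=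
  Matrix.fromCols (ρ • matSc A X) (blockRow fun i => η i • matU A X i)

theorem matSc_mulVec_realify (v : Fin n × Fin n → ℂ) :
    matSc A X *ᵥ realify v = realify ((matL A X)⁻¹ *ᵥ v) := by
  have h := fromBlocks_mulVec_realify (matL A X)⁻¹ 0 v
  simpa [rePart, imPart, matSc, Matrix.map_zero] using h

theorem matU_mulVec_realify_vec (i : Fin m) (E : Matrix (Fin n) (Fin n) ℂ) :
    matU A X i *ᵥ realify E.vec =
      realify ((matL A X)⁻¹ *ᵥ (Eᴴ * matB A X i + (matB A X i)ᴴ * E).vec) := by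
  -- The conjugate-linear part is `E ↦ Eᴴ * B`: conjugation followed by `Π` produces `vec Eᴴ`.
  have hstar : vecPerm n *ᵥ star E.vec = Eᴴ.vec := vecPerm_mulVec_vec (E.map star)
  rw [matU, fromBlocks_mulVec_realify, matV1, matV2, ← Matrix.mulVec_mulVec,
    ← Matrix.mulVec_mulVec, ← Matrix.mulVec_mulVec, hstar, Matrix.kronecker_mulVec_vec,
    Matrix.kronecker_mulVec_vec, ← Matrix.mulVec_add, Matrix.vec_add, add_comm]
  simp

theorem blockRow_mulVec {r c : Type*} [Fintype c] (M : Fin m → Matrix r c ℝ)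
    (y : Fin m × c → ℝ) : blockRow M *ᵥ y = ∑ i, M i *ᵥ fun j => y (i, j) := by
  ext k
  simp [Matrix.mulVec, dotProduct, blockRow, Fintype.sum_prod_type]

/-- A weighted perturbation as a real vector. -/
def packVec (η : Fin m → ℝ) (ρ : ℝ) (E : Fin m → Matrix (Fin n) (Fin n) ℂ)
    (F : Matrix (Fin n) (Fin n) ℂ) :
    ((Fin n × Fin n) ⊕ (Fin n × Fin n)) ⊕ (Fin m × ((Fin n × Fin n) ⊕ (Fin n × Fin n))) → ℝ :=
  Sum.elim (realify (ρ⁻¹ • F).vec) fun p => realify ((η p.1)⁻¹ • E p.1).vec p.2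

variable {η : Fin m → ℝ} {ρ : ℝ}

theorem norm_packVec (E : Fin m → Matrix (Fin n) (Fin n) ℂ) (F : Matrix (Fin n) (Fin n) ℂ) :
    ‖WithLp.toLp 2 (packVec η ρ E F)‖ = perturbationNorm η ρ E F := by
  refine (sq_eq_sq₀ (norm_nonneg _) (perturbationNorm_nonneg _ _ _ _)).1 ?_
  rw [EuclideanSpace.norm_sq_eq, perturbationNorm_sq]
  rw [Fintype.sum_sum_type, Fintype.sum_prod_type, add_comm]
  simp only [Real.norm_eq_abs, sq_abs, packVec, Sum.elim_inl, Sum.elim_inr, sum_sq_realify_vec]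

theorem norm_realify_vec (Z : Matrix (Fin n) (Fin n) ℂ) :
    ‖WithLp.toLp 2 (realify Z.vec)‖ = frobNorm Z := by
  refine (sq_eq_sq₀ (norm_nonneg _) (frobNorm_nonneg _)).1 ?_
  rw [EuclideanSpace.norm_sq_eq, ← sum_sq_realify_vec]
  simp only [Real.norm_eq_abs, sq_abs]

theorem packVec_surjective (hη : ∀ i, 0 < η i) (hρ : 0 < ρ)
    (w : ((Fin n × Fin n) ⊕ (Fin n × Fin n)) ⊕ (Fin m × ((Fin n × Fin n) ⊕ (Fin n × Fin n))) → ℝ) :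
    ∃ E F, packVec η ρ E F = w := by
  have h : ∀ v : (Fin n × Fin n) ⊕ (Fin n × Fin n) → ℝ,
      ∃ M : Matrix (Fin n) (Fin n) ℂ, realify M.vec = v := fun v => by
    obtain ⟨x, rfl⟩ := realify_surjective v
    obtain ⟨M, rfl⟩ := Matrix.vec_bijective.surjective x
    exact ⟨M, rfl⟩
  obtain ⟨F, hF⟩ := h fun j => w (.inl j)
  choose E hE using fun i : Fin m => h fun j => w (.inr (i, j))
  refine ⟨fun i => η i • E i, ρ • F, ?_⟩
  ext (j | ⟨i, j⟩)
  · simp [packVec, smul_smul, inv_mul_cancel₀ hρ.ne', hF]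
  · simp [packVec, smul_smul, inv_mul_cancel₀ (hη i).ne', hE]

theorem IsPosDefSolution.condMatrix_mulVec_packVec (hQ : Q.PosDef) (hX : IsPosDefSolution A Q X)
    (hη : ∀ i, 0 < η i) (hρ : 0 < ρ) {E : Fin m → Matrix (Fin n) (Fin n) ℂ}
    {F Z : Matrix (Fin n) (Fin n) ℂ}
    (hZ : steinMap (matB A X) Z = F + ∑ i, ((E i)ᴴ * matB A X i + (matB A X i)ᴴ * E i)) :
    condMatrix η ρ A X *ᵥ packVec η ρ E F = realify Z.vec := by
  have hL : (matL A X)⁻¹ *ᵥ (steinMap (matB A X) Z).vec = Z.vec := by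
    rw [← matL_mulVec_vec, Matrix.mulVec_mulVec, Matrix.nonsing_inv_mul _
      ((Matrix.isUnit_iff_isUnit_det _).1 (hX.isUnit_matL hQ)), Matrix.one_mulVec]
  rw [packVec, Matrix.fromCols_mulVec_sumElim, blockRow_mulVec, ← hL, hZ, Matrix.vec_add,
    Matrix.vec_sum, Matrix.mulVec_add, Matrix.mulVec_sum, realify_add, realify_sum]
  congr 1
  · rw [Matrix.vec_smul, realify_smul, Matrix.smul_mulVec, Matrix.mulVec_smul, smul_smul,
      mul_inv_cancel₀ hρ.ne', one_smul, matSc_mulVec_realify]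
  · refine Finset.sum_congr rfl fun i _ => ?_
    change (η i • matU A X i) *ᵥ realify ((η i)⁻¹ • E i).vec = _
    rw [Matrix.vec_smul, realify_smul, Matrix.smul_mulVec, Matrix.mulVec_smul,
      smul_smul, mul_inv_cancel₀ (hη i).ne', one_smul, matU_mulVec_realify_vec]

theorem IsPosDefSolution.frobNorm_le_specNorm_mul (hQ : Q.PosDef) (hX : IsPosDefSolution A Q X)
    (hη : ∀ i, 0 < η i) (hρ : 0 < ρ) {E : Fin m → Matrix (Fin n) (Fin n) ℂ}
    {F Z : Matrix (Fin n) (Fin n) ℂ}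
    (hZ : steinMap (matB A X) Z = F + ∑ i, ((E i)ᴴ * matB A X i + (matB A X i)ᴴ * E i)) :
    frobNorm Z ≤ specNorm (condMatrix η ρ A X) * perturbationNorm η ρ E F := by
  rw [← norm_realify_vec, ← hX.condMatrix_mulVec_packVec hQ hη hρ hZ, ← norm_packVec]
  exact norm_mulVec_le_specNorm_mul _ _

/-- The spectral norm of the matrix `(ρ S_c, η₁ U₁, …, ηₘ Uₘ)` is determined by the perturbations
with Hermitian last component. -/
theorem IsPosDefSolution.specNorm_le (hQ : Q.PosDef) (hX : IsPosDefSolution A Q X)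
    (hη : ∀ i, 0 < η i) (hρ : 0 < ρ) {K : ℝ} (hK : 0 ≤ K)
    (h : ∀ (E : Fin m → Matrix (Fin n) (Fin n) ℂ) (F Z : Matrix (Fin n) (Fin n) ℂ),
      F.IsHermitian →
      steinMap (matB A X) Z = F + ∑ i, ((E i)ᴴ * matB A X i + (matB A X i)ᴴ * E i) →
      frobNorm Z ≤ K * perturbationNorm η ρ E F) :
    specNorm (condMatrix η ρ A X) ≤ K := by
  have hinj := hX.steinMap_injective hQ
  have hsurj := LinearMap.injective_iff_surjective.1 hinj
  have hherm : ∀ {Z : Matrix (Fin n) (Fin n) ℂ}, (steinMap (matB A X) Z).IsHermitian →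
      Z.IsHermitian := fun hZ => hinj ((steinMap_conjTranspose _ _).trans hZ)
  refine specNorm_le_of_forall hK fun w => ?_
  obtain ⟨E, F, hw⟩ := packVec_surjective hη hρ w
  -- Attach all of `E` to `H` and none to `G`. Both responses `Z₁`, `Z₂` are Hermitian because the
  -- Stein operator commutes with the adjoint, so `Z₁ + i Z₂` and `H + i G` split orthogonally and
  -- the two squared bounds add.
  obtain ⟨H, G, hH, hG, rfl⟩ := exists_hermitian_add_I_smul F
  obtain ⟨Z₁, hZ₁⟩ := hsurj (H + ∑ i, ((E i)ᴴ * matB A X i + (matB A X i)ᴴ * E i))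
  obtain ⟨Z₂, hZ₂⟩ := hsurj G
  have hcross : (∑ i, ((E i)ᴴ * matB A X i + (matB A X i)ᴴ * E i)).IsHermitian := by
    simp [Matrix.IsHermitian, Matrix.conjTranspose_sum, add_comm]
  have hZ₁h : Z₁.IsHermitian := hherm (hZ₁ ▸ hH.add hcross)
  have hZ₂h : Z₂.IsHermitian := hherm (hZ₂ ▸ hG)
  have hZ : steinMap (matB A X) (Z₁ + Complex.I • Z₂) =
      (H + Complex.I • G) + ∑ i, ((E i)ᴴ * matB A X i + (matB A X i)ᴴ * E i) := by
    rw [map_add, map_smul, hZ₁, hZ₂]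
    abel
  have hb₁ := h E H Z₁ hH hZ₁
  have hb₂ := h 0 G Z₂ hG (by simp [hZ₂])
  have hfinal : frobNorm (Z₁ + Complex.I • Z₂) ≤
      K * perturbationNorm η ρ E (H + Complex.I • G) := by
    refine (sq_le_sq₀ (frobNorm_nonneg _)
      (mul_nonneg hK (perturbationNorm_nonneg _ _ _ _))).1 ?_
    rw [frobNorm_add_I_smul_sq hZ₁h hZ₂h, mul_pow, perturbationNorm_sq, smul_add,
      smul_comm ρ⁻¹ Complex.I G,
      frobNorm_add_I_smul_sq (hH.smul (star_trivial _)) (hG.smul (star_trivial _))]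
    have h1 := pow_le_pow_left₀ (frobNorm_nonneg _) hb₁ 2
    have h2 := pow_le_pow_left₀ (frobNorm_nonneg _) hb₂ 2
    rw [mul_pow, perturbationNorm_sq] at h1 h2
    have h0 : ∑ i : Fin m,
        frobNorm ((η i)⁻¹ • (0 : Fin m → Matrix (Fin n) (Fin n) ℂ) i) ^ 2 = 0 := by
      simp [frobNorm_sq]
    rw [h0] at h2
    linarith
  rw [← norm_realify_vec, ← hX.condMatrix_mulVec_packVec hQ hη hρ hZ, ← norm_packVec, hw] at hfinal
  exact hfinal

end SpectralNorm

/-! ### The limit defining the condition number. -/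

section ConditionNumber

open scoped Matrix.Norms.Frobenius

variable {m n : ℕ} {A : Fin m → Matrix (Fin n) (Fin n) ℂ} {Q X : Matrix (Fin n) (Fin n) ℂ}
  {η : Fin m → ℝ} {ξ ρ : ℝ}

theorem norm_le_mul_perturbationNorm (hη : ∀ i, 0 < η i) (hρ : 0 < ρ)
    (E : Fin m → Matrix (Fin n) (Fin n) ℂ) (F : Matrix (Fin n) (Fin n) ℂ) :
    ‖(E, F)‖ ≤ (∑ i, η i + ρ) * perturbationNorm η ρ E F := by
  have hN := perturbationNorm_nonneg η ρ E F
  have hsq := perturbationNorm_sq η ρ E F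
  have hηs : 0 ≤ ∑ i, η i := Finset.sum_nonneg fun i _ => (hη i).le
  have hbound : ∀ (t : ℝ) (M : Matrix (Fin n) (Fin n) ℂ), 0 < t → t ≤ ∑ i, η i + ρ →
      frobNorm (t⁻¹ • M) ≤ perturbationNorm η ρ E F →
      ‖M‖ ≤ (∑ i, η i + ρ) * perturbationNorm η ρ E F := by
    intro t M ht hle h
    have h1 : ‖M‖ = t * frobNorm (t⁻¹ • M) := by
      rw [frobNorm_smul, abs_of_pos (inv_pos.2 ht), mul_inv_cancel_left₀ ht.ne', frobNorm]
    rw [h1]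
    exact mul_le_mul hle h (frobNorm_nonneg _) (ht.le.trans hle)
  have hsum : 0 ≤ ∑ i, frobNorm ((η i)⁻¹ • E i) ^ 2 := Finset.sum_nonneg fun i _ => sq_nonneg _
  refine max_le ((pi_norm_le_iff_of_nonneg (by positivity)).2 fun i => ?_) ?_
  · have hi := Finset.single_le_sum (f := fun i => frobNorm ((η i)⁻¹ • E i) ^ 2)
      (fun _ _ => sq_nonneg _) (Finset.mem_univ i)
    have hi' := Finset.single_le_sum (f := η) (fun i _ => (hη i).le) (Finset.mem_univ i)
    refine hbound _ _ (hη i) (by linarith) ((sq_le_sq₀ (frobNorm_nonneg _) hN).1 ?_)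
    have := sq_nonneg (frobNorm (ρ⁻¹ • F))
    linarith
  · exact hbound _ _ hρ (by linarith) ((sq_le_sq₀ (frobNorm_nonneg _) hN).1 (by linarith))

/-- For small `δ`, uniqueness forces every admissible `X + ΔX` to lie on the local branch, so the
first-order expansion controls all competitors at once. -/
theorem IsPosDefSolution.eventually_perturbationSup_le (hQ : Q.PosDef)
    (hX : IsPosDefSolution A Q X) (hξ : 0 < ξ) (hη : ∀ i, 0 < η i) (hρ : 0 < ρ) {ε : ℝ}
    (hε : 0 < ε) :
    ∀ᶠ δ in 𝓝[>] 0, perturbationSup ξ η ρ A Q X δ ≤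
      ENNReal.ofReal (1 / ξ * (specNorm (condMatrix η ρ A X) + ε)) := by
  obtain ⟨φ, T, hT, hS, r, hr, hsol⟩ := hX.exists_local_solution hQ
  set C := ∑ i, η i + ρ
  have hC : 0 < C := add_pos_of_nonneg_of_pos (Finset.sum_nonneg fun i _ => (hη i).le) hρ
  obtain ⟨r', hr', hT⟩ := hT (ε / C) (by positivity)
  have hsmall : ∀ᶠ δ : ℝ in 𝓝[>] 0, C * δ < min r r' := by
    have hc : Continuous fun δ : ℝ => C * δ := by fun_prop
    have ht := (hc.tendsto 0).mono_left (nhdsWithin_le_nhds (s := Set.Ioi 0))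
    rw [mul_zero] at ht
    exact ht.eventually_lt_const (lt_min hr hr')
  filter_upwards [hsmall, self_mem_nhdsWithin] with δ hδr hδ
  have hδ : 0 < δ := hδ
  refine iSup_le fun E => iSup_le fun F => iSup_le fun Z => iSup_le ?_
  rintro ⟨hN, hF, hQF, hsolZ⟩
  refine ENNReal.ofReal_le_ofReal ?_
  have hEF := norm_le_mul_perturbationNorm hη hρ E F
  have hlt : ‖(E, F)‖ < min r r' :=
    (hEF.trans (mul_le_mul_of_nonneg_left hN hC.le)).trans_lt hδr
  have hφ : X + Z = φ (A + E, Q + F) :=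
    IsPosDefSolution.unique hQF hsolZ (hsol E F (hlt.trans_le (min_le_left _ _)) hF).2
  have h1 := hT E F (hlt.trans_le (min_le_right _ _))
  rw [← hφ, add_sub_cancel_left] at h1
  have h2 : ‖T (E, F)‖ ≤ specNorm (condMatrix η ρ A X) * perturbationNorm η ρ E F :=
    hX.frobNorm_le_specNorm_mul hQ hη hρ (hS E F)
  have h3 : frobNorm Z ≤ (specNorm (condMatrix η ρ A X) + ε) * δ := by
    have h4 : ‖Z‖ ≤ ‖T (E, F)‖ + ‖Z - T (E, F)‖ := norm_le_norm_add_norm_sub' _ _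
    have h5 : ε / C * ‖(E, F)‖ ≤ ε * perturbationNorm η ρ E F := by
      calc ε / C * ‖(E, F)‖ ≤ ε / C * (C * perturbationNorm η ρ E F) := by gcongr
        _ = ε * perturbationNorm η ρ E F := by field_simp
    have hK := specNorm_nonneg (condMatrix η ρ A X)
    calc frobNorm Z ≤ (specNorm (condMatrix η ρ A X) + ε) * perturbationNorm η ρ E F := by
          rw [frobNorm]
          linarith
      _ ≤ _ := by gcongr
  rw [div_le_iff₀ (by positivity)]
  calc frobNorm Z ≤ (specNorm (condMatrix η ρ A X) + ε) * δ := h3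
    _ = 1 / ξ * (specNorm (condMatrix η ρ A X) + ε) * (ξ * δ) := by field_simp

theorem IsPosDefSolution.eventually_le_perturbationSup (hQ : Q.PosDef)
    (hX : IsPosDefSolution A Q X) (hξ : 0 < ξ) (hη : ∀ i, 0 < η i) (hρ : 0 < ρ) {ε : ℝ}
    (hε : 0 < ε) :
    ∀ᶠ δ in 𝓝[>] 0, ENNReal.ofReal (1 / ξ * (specNorm (condMatrix η ρ A X) - ε)) ≤
      perturbationSup ξ η ρ A Q X δ := by
  -- `specNorm_le` needs a nonnegative constant; in the other case the claimed lower bound is zero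
  -- in `ℝ≥0∞`.
  rcases le_or_gt (specNorm (condMatrix η ρ A X) - ε / 2) 0 with hneg | hpos
  · refine Eventually.of_forall fun δ => ?_
    rw [ENNReal.ofReal_of_nonpos]
    · exact zero_le
    · exact mul_nonpos_of_nonneg_of_nonpos (by positivity) (by linarith)
  obtain ⟨φ, T, hT, hS, r, hr, hsol⟩ := hX.exists_local_solution hQ
  -- A nearly extremal Hermitian direction costs `ε / 2`; the remainder of the expansion may cost
  -- the other half.
  obtain ⟨E, F, hF, hEF⟩ : ∃ E F, F.IsHermitian ∧
      (specNorm (condMatrix η ρ A X) - ε / 2) * perturbationNorm η ρ E F < ‖T (E, F)‖ := by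
    by_contra! h
    have := hX.specNorm_le hQ hη hρ hpos.le fun E F Z hF hZ => by
      rw [hX.steinMap_injective hQ (hZ.trans (hS E F).symm)]
      exact h E F hF
    linarith
  have hN : 0 < perturbationNorm η ρ E F := by
    refine (perturbationNorm_nonneg η ρ E F).lt_of_ne fun h0 => ?_
    have h1 : ‖T (E, F)‖ ≤ specNorm (condMatrix η ρ A X) * perturbationNorm η ρ E F :=
      hX.frobNorm_le_specNorm_mul hQ hη hρ (hS E F)
    rw [← h0, mul_zero] at h1 hEF
    linarith
  set N := perturbationNorm η ρ E F
  obtain ⟨r', hr', hT⟩ := hT (ε / 2 * N / (‖(E, F)‖ + 1)) (by positivity)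
  have hsmall : ∀ᶠ δ : ℝ in 𝓝[>] 0, δ / N * ‖(E, F)‖ < min r r' := by
    have hc : Continuous fun δ : ℝ => δ / N * ‖(E, F)‖ := by fun_prop
    have ht := (hc.tendsto 0).mono_left (nhdsWithin_le_nhds (s := Set.Ioi 0))
    rw [zero_div, zero_mul] at ht
    exact ht.eventually_lt_const (lt_min hr hr')
  filter_upwards [hsmall, self_mem_nhdsWithin] with δ hδr hδ
  have hδ : 0 < δ := hδ
  -- This scaling gives the perturbation weighted size exactly `δ`.
  set t := δ / N
  have ht : 0 < t := div_pos hδ hN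
  have hnorm : ‖(t • E, t • F)‖ = t * ‖(E, F)‖ := by
    rw [← Prod.smul_mk, norm_smul, Real.norm_of_nonneg ht.le]
  have hlt : ‖(t • E, t • F)‖ < min r r' := hnorm ▸ hδr
  have hFt : (t • F).IsHermitian := hF.smul (star_trivial _)
  obtain ⟨hQF, hsolF⟩ := hsol (t • E) (t • F) (hlt.trans_le (min_le_left _ _)) hFt
  have h1 := hT (t • E) (t • F) (hlt.trans_le (min_le_right _ _))
  set Z := φ (A + t • E, Q + t • F) - X with hZdef
  rw [hnorm, ← Prod.smul_mk, map_smul] at h1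
  have hadm : perturbationNorm η ρ (t • E) (t • F) ≤ δ ∧ (t • F).IsHermitian ∧
      (Q + t • F).PosDef ∧
      IsPosDefSolution (fun i => A i + (t • E) i) (Q + t • F) (X + Z) := by
    refine ⟨?_, hFt, hQF, ?_⟩
    · rw [perturbationNorm_smul, abs_of_pos ht]
      exact (div_mul_cancel₀ δ hN.ne').le
    · rw [hZdef, add_sub_cancel]
      exact hsolF
  refine le_trans (ENNReal.ofReal_le_ofReal ?_) (le_iSup_of_le (t • E) (le_iSup_of_le (t • F)
    (le_iSup_of_le Z (le_iSup_of_le hadm le_rfl))))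
  have h2 : ε / 2 * N / (‖(E, F)‖ + 1) * (t * ‖(E, F)‖) ≤ ε / 2 * δ := by
    have h3 : ‖(E, F)‖ / (‖(E, F)‖ + 1) ≤ 1 := (div_le_one (by positivity)).2 (by linarith)
    calc ε / 2 * N / (‖(E, F)‖ + 1) * (t * ‖(E, F)‖)
        = ε / 2 * (t * N) * (‖(E, F)‖ / (‖(E, F)‖ + 1)) := by ring
      _ ≤ ε / 2 * (t * N) * 1 := by gcongr
      _ = ε / 2 * δ := by rw [mul_one, div_mul_cancel₀ δ hN.ne']
  have h4 : ‖t • T (E, F)‖ ≤ ‖Z‖ + ‖Z - t • T (E, F)‖ := norm_le_norm_add_norm_sub _ _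
  have h5 : (specNorm (condMatrix η ρ A X) - ε / 2) * δ ≤ ‖t • T (E, F)‖ := by
    rw [norm_smul, Real.norm_of_nonneg ht.le]
    calc (specNorm (condMatrix η ρ A X) - ε / 2) * δ
        = t * ((specNorm (condMatrix η ρ A X) - ε / 2) * N) := by
          rw [mul_left_comm, div_mul_cancel₀ δ hN.ne']
      _ ≤ t * ‖T (E, F)‖ := by gcongr
  have h6 : (specNorm (condMatrix η ρ A X) - ε) * δ ≤ frobNorm Z := by
    rw [frobNorm]
    linarith
  rw [le_div_iff₀ (by positivity)]
  calc 1 / ξ * (specNorm (condMatrix η ρ A X) - ε) * (ξ * δ)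
      = (specNorm (condMatrix η ρ A X) - ε) * δ := by field_simp
    _ ≤ frobNorm Z := h6

theorem IsPosDefSolution.isConditionNumber (hQ : Q.PosDef) (hX : IsPosDefSolution A Q X)
    (hξ : 0 < ξ) (hη : ∀ i, 0 < η i) (hρ : 0 < ρ) :
    IsConditionNumber ξ η ρ A Q X
      (ENNReal.ofReal (1 / ξ * specNorm (condMatrix η ρ A X))) := by
  set K := specNorm (condMatrix η ρ A X)
  -- The values `σ = -1` and `σ = 1` serve the lower and the upper bound.
  have hlim : ∀ σ : ℝ, Tendsto (fun ε : ℝ => ENNReal.ofReal (1 / ξ * (K + σ * ε))) (𝓝[>] 0)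
      (𝓝 (ENNReal.ofReal (1 / ξ * K))) := by
    intro σ
    have hc : Continuous fun ε : ℝ => ENNReal.ofReal (1 / ξ * (K + σ * ε)) :=
      ENNReal.continuous_ofReal.comp (by fun_prop)
    simpa using (hc.tendsto 0).mono_left (nhdsWithin_le_nhds (s := Set.Ioi 0))
  refine tendsto_order.2 ⟨fun a ha => ?_, fun a ha => ?_⟩
  · obtain ⟨ε, hε, hε0⟩ :=
      (((hlim (-1)).eventually_const_lt ha).and self_mem_nhdsWithin).exists
    filter_upwards [hX.eventually_le_perturbationSup hQ hξ hη hρ hε0] with δ hδ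
    refine lt_of_lt_of_le hε (le_trans (le_of_eq ?_) hδ)
    congr 2
    ring
  · obtain ⟨ε, hε, hε0⟩ :=
      (((hlim 1).eventually_lt_const ha).and self_mem_nhdsWithin).exists
    filter_upwards [hX.eventually_perturbationSup_le hQ hξ hη hρ hε0] with δ hδ
    refine lt_of_le_of_lt (hδ.trans (le_of_eq ?_)) hε
    congr 2
    ring

end ConditionNumber

end MatrixCond

end

theorem theorem6p1 {m n : ℕ} (A : Fin m → Matrix (Fin n) (Fin n) ℂ)
    (Q : Matrix (Fin n) (Fin n) ℂ) (hQ : Q.PosDef)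
    (ξ ρ : ℝ) (η : Fin m → ℝ) (hξ : 0 < ξ) (hρ : 0 < ρ) (hη : ∀ i, 0 < η i) :
    ∃ X : Matrix (Fin n) (Fin n) ℂ,
      MatrixCond.IsPosDefSolution A Q X ∧
      (∀ Y, MatrixCond.IsPosDefSolution A Q Y → Y = X) ∧
      IsUnit (MatrixCond.matL A X) ∧
      MatrixCond.IsConditionNumber ξ η ρ A Q X
        (ENNReal.ofReal ((1 / ξ) * MatrixCond.specNorm
          (Matrix.fromCols (ρ • MatrixCond.matSc A X)
            (MatrixCond.blockRow fun i => η i • MatrixCond.matU A X i)))) := by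
  obtain ⟨X, hX⟩ := MatrixCond.exists_isPosDefSolution A hQ
  exact ⟨X, hX, fun Y hY => hY.unique hQ hX, hX.isUnit_matL hQ,
    hX.isConditionNumber hQ hξ hη hρ⟩
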